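/- For a finite list $a_\bullet=(a_1,\dots,a_m)$ of nonnegative integers with even sum put $n(a_\bullet):=\frac12(a_1+\cdots+a_m+2)$, and let $K(a_\bullet)$ be the Kostka number of two-rowed rectangular shape: the number of semistandard Young tableaux of shape $(n(a_\bullet)-1,\,n(a_\bullet)-1)$ and content $a_\bullet$, that is, of arrays of two rows of length $n(a_\bullet)-1$ whose entries increase weakly along rows and strictly down columns and in which $i$ occurs exactly $a_i$ times for $i=1,\dots,m$. A Schubert problem (of lines) is a list $a_\bullet$ of positive integers with even sum; it is reduced if $a_i+a_j<n(a_\bullet)$ for all $i<j$. A rearrangement of $a_\bullet$ is a listing of its entries in some order. Let $a_\bullet$ be a reduced Schubert problem involving $m\ge 4$ integers. If $a_\bullet\neq(1,1,1,1)$, then $a_\bullet$ has a rearrangement $(a_1,\dots,a_m)$ such that \[ K(a_1,\dots,a_{m-2},\,a_{m-1}+a_m)\ \neq\ K(a_1,\dots,a_{m-2},\,a_{m-1}-1,\,a_m-1), \] and both terms are nonzero. If $a_\bullet=(1,1,1,1)$, then the two terms are equal, both being $1$; that is, $K(1,1,2)=K(1,1,0,0)=1$. -/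

import Mathlib

/-!
`K(a)` is the multiplicity of the trivial module in `V_{a₁} ⊗ ⋯ ⊗ V_{aₘ}`, where `V_x` is the
irreducible `SL₂`-module of highest weight `x`: a tableau is determined by its second row, and the
lattice-word condition on that row is the one that governs stripping off tensor factors.

If two entries `y < z` of `a` differ, let `x` be a third one and let `c` list the others. By
Clebsch–Gordan, `K(c, x, y, z)` is the sum of the two terms for the last pair, whichever two of
`x, y, z` are chosen to form it. If the terms were equal both for `(x, y)` and for `(x, z)`, then
`K(c, z, x + y) = K(c, y, x + z)`; but the summands of the second also occur in the first, with a
positive one to spare.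

If `a = (t, …, t)`, let `N(h)` be the multiplicity of `V_h` in the tensor product of all but two
factors. The terms are `N(2t)` and `N(0) + N(2) + ⋯ + N(2t - 2)`, and the point is that
`N(h) / (h + 1)` decreases in steps of two. This is a discrete form of the fact that convolving
radially decreasing densities on `ℝ³ = su(2)*` gives a radially decreasing density: the cone of such
functions is spanned by indicators of balls, for which the claim is checked by hand. Since
`1 + 3 + ⋯ + (2t - 1) = t² > 2t + 1` for `t ≥ 3`, the second term is then the larger one. For
`t = 1` the difference is a single positive multiplicity. For `t = 2` the multiplicities are
differences of Riordan numbers; their three-term recurrence turns equality of the two terms into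
`4 N(2) = (n - 3) N(0)` with `n` factors, so `N(2) ≤ 3 N(0)` leaves finitely many `n` to check.
-/

namespace SchubertLines

/-- A Schubert problem of lines: a list of positive integers with even sum. -/
def IsSchubertProblem (a : List ℕ) : Prop :=
  (∀ x ∈ a, 0 < x) ∧ Even a.sum

/-- `n(a) = (a₁ + ⋯ + aₘ + 2) / 2`, the dimension of the ambient projective space. -/
def ambientDim (a : List ℕ) : ℕ := (a.sum + 2) / 2

/-- A Schubert problem is reduced if `aᵢ + aⱼ < n(a)` for all positions `i < j`. -/
def IsReduced (a : List ℕ) : Prop :=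
  IsSchubertProblem a ∧
    ∀ i j : Fin a.length, i < j → a.get i + a.get j < ambientDim a

/-- The Young diagram of the rectangular partition `(k, k)`. -/
def twoRows (k : ℕ) : YoungDiagram where
  cells := Finset.range 2 ×ˢ Finset.range k
  isLowerSet := by
    rintro ⟨i, j⟩ ⟨i', j'⟩ h hc
    obtain ⟨h₁, h₂⟩ := Prod.mk_le_mk.mp h
    simp only [Finset.coe_product, Finset.coe_range, Set.mem_prod, Set.mem_Iio] at hc ⊢
    omega

/-- The semistandard Young tableaux of shape `(n(a) - 1, n(a) - 1)` and content
`a = (a₁, …, aₘ)`: the entry `i` occurs exactly `aᵢ` times, for `i = 1, …, m`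
(list positions start at `0`, so position `i` of the list belongs to the entry `i + 1`).
When the sum of `a` is even, the shape has `a₁ + ⋯ + aₘ` cells, so there are no other entries. -/
def tableaux (a : List ℕ) : Set (SemistandardYoungTableau (twoRows (ambientDim a - 1))) :=
  {T | ∀ i : Fin a.length,
    ((twoRows (ambientDim a - 1)).cells.filter fun c => T c.1 c.2 = (i : ℕ) + 1).card = a.get i}

/-- The Kostka number `K(a)`. Zero entries of `a` are allowed. -/
noncomputable def K (a : List ℕ) : ℕ := (tableaux a).ncard

end SchubertLines

namespace SchubertLines

open Filter Finset

/-- The multiplicity of the irreducible `SL₂`-module of highest weight `h` in the tensor product of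
the irreducible modules whose highest weights are the entries of the list, computed by stripping off
one tensor factor at a time. -/
def mult : List ℕ → ℕ → ℕ
  | [], h => if h = 0 then 1 else 0
  | x :: l, h => ∑ q ∈ range (min h x + 1), mult l (h + x - 2 * q)

/-- The lists of second-row multiplicities with which the content given by the list can be added
to a two-row tableau whose first row exceeds the second by `h`, so that the shape becomes a
rectangle. -/
def fillings : List ℕ → ℕ → Finset (List ℕ)
  | [], h => if h = 0 then {[]} else ∅
  | x :: l, h => (range (min h x + 1)).biUnion fun q =>
      (fillings l (h + x - 2 * q)).image (List.cons q)

lemma card_fillings (l : List ℕ) (h : ℕ) : #(fillings l h) = mult l h := by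
  induction l generalizing h with
  | nil => rw [fillings, mult]; split_ifs <;> rfl
  | cons x l ih =>
    rw [fillings, mult, card_biUnion]
    · simp only [card_image_of_injective _ List.cons_injective, ih]
    · intro q _ q' _ hq
      simp only [Function.onFun, disjoint_left, mem_image, not_exists, not_and]
      rintro _ ⟨s, _, rfl⟩ t _ hts
      exact hq (List.cons.inj hts).1.symm

lemma mem_fillings_iff {l s : List ℕ} {h : ℕ} :
    s ∈ fillings l h ↔ List.Forall₂ (· ≤ ·) s l ∧
      (∀ i, (s.take i).sum + (s.take (i + 1)).sum ≤ h + (l.take i).sum) ∧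
      2 * s.sum = h + l.sum := by
  induction l generalizing s h with
  | nil =>
    rw [fillings, List.forall₂_nil_right_iff]
    constructor
    · split_ifs with hh <;> simp +contextual [hh]
    · rintro ⟨rfl, -, hsum⟩
      simp [show h = 0 by simpa using hsum.symm]
  | cons x l ih =>
    simp only [fillings, mem_biUnion, mem_range, mem_image, List.forall₂_cons_right_iff]
    constructor
    · rintro ⟨q, hq, s, hs, rfl⟩
      obtain ⟨hle, hlattice, hsum⟩ := ih.1 hs
      refine ⟨⟨q, s, by omega, hle, rfl⟩, fun i => ?_, by simp only [List.sum_cons]; omega⟩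
      cases i with
      | zero => simp only [List.take_zero, List.take_succ_cons, List.sum_cons, List.sum_nil]; omega
      | succ i =>
        have := hlattice i
        simp only [List.take_succ_cons, List.sum_cons]
        omega
    · rintro ⟨⟨q, s, hqx, hle, rfl⟩, hlattice, hsum⟩
      have hqh : q ≤ h := by simpa using hlattice 0
      refine ⟨q, by omega, s, ih.2 ⟨hle, fun i => ?_, ?_⟩, rfl⟩
      · have := hlattice (i + 1)
        simp only [List.take_succ_cons, List.sum_cons] at this
        omega
      · simp only [List.sum_cons] at hsum; omega

lemma mem_twoRows {k r j : ℕ} : (r, j) ∈ twoRows k ↔ r < 2 ∧ j < k := by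
  rw [← YoungDiagram.mem_cells, twoRows, mem_product, mem_range, mem_range]

section Tableaux

variable {k : ℕ} (T : SemistandardYoungTableau (twoRows k)) {a : List ℕ}

/-- The number of entries at most `i` in row `r` of a tableau. -/
def rowCount (r i : ℕ) : ℕ := #{j ∈ range k | T r j ≤ i}

/-- The tableau has content `a`: the entry `i + 1` occurs `a[i]` times. -/
def HasContent (a : List ℕ) : Prop :=
  ∀ i (hi : i < a.length), #{c ∈ (twoRows k).cells | T c.1 c.2 = i + 1} = a[i]

lemma entry_le_iff {r j : ℕ} (hr : r < 2) (hj : j < k) (i : ℕ) :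
    T r j ≤ i ↔ j < rowCount T r i := by
  constructor
  · intro h
    have hsub : range (j + 1) ⊆ {j ∈ range k | T r j ≤ i} := fun j' hj' => by
      have hj' := mem_range.1 hj'
      exact mem_filter.2 ⟨mem_range.2 (by omega),
        (T.row_weak_of_le (by omega) (mem_twoRows.2 ⟨hr, hj⟩)).trans h⟩
    simpa [rowCount] using card_le_card hsub
  · intro h
    by_contra hlt
    have hsub : ({j ∈ range k | T r j ≤ i} : Finset ℕ) ⊆ range j := fun j' hj' => by
      obtain ⟨hj'k, hj'i⟩ := mem_filter.1 hj'
      by_contra hle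
      exact hlt ((T.row_weak_of_le (not_lt.1 (mt mem_range.2 hle))
        (mem_twoRows.2 ⟨hr, mem_range.1 hj'k⟩)).trans hj'i)
    exact absurd h (by simpa [rowCount] using card_le_card hsub)

lemma rowCount_le (r i : ℕ) : rowCount T r i ≤ k :=
  (card_filter_le _ _).trans (card_range k).le

lemma rowCount_mono (r : ℕ) : Monotone (rowCount T r) := fun _ _ h =>
  card_le_card (monotone_filter_right _ fun _ _ hj => le_trans hj h)

lemma rowCount_succ (r i : ℕ) :
    rowCount T r (i + 1) = rowCount T r i + #{j ∈ range k | T r j = i + 1} := by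
  rw [rowCount, rowCount, ← card_union_of_disjoint]
  · congr 1
    ext j
    simp only [mem_filter, mem_union, mem_range]
    omega
  · rw [disjoint_left]
    intro j
    simp only [mem_filter]
    omega

lemma rowCount_one_succ_le (i : ℕ) : rowCount T 1 (i + 1) ≤ rowCount T 0 i := by
  by_contra! h
  have hk : rowCount T 0 i < k := h.trans_le (rowCount_le T 1 (i + 1))
  have hlower := (entry_le_iff T one_lt_two hk (i + 1)).2 h
  have hstrict := T.col_strict zero_lt_one (mem_twoRows.2 ⟨one_lt_two, hk⟩)
  exact lt_irrefl _ ((entry_le_iff T two_pos hk i).1 (by omega))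

variable {T} in
lemma tableau_ext {T' : SemistandardYoungTableau (twoRows k)}
    (h : ∀ r < 2, ∀ i, rowCount T r i = rowCount T' r i) : T = T' := by
  ext r j
  by_cases hc : (r, j) ∈ twoRows k
  · obtain ⟨hr, hj⟩ := mem_twoRows.1 hc
    refine eq_of_forall_ge_iff fun i => ?_
    rw [entry_le_iff T hr hj, entry_le_iff T' hr hj, h r hr i]
  · rw [T.zeros hc, T'.zeros hc]

lemma card_filter_eq_rowCount_sub (i : ℕ) :
    #{c ∈ (twoRows k).cells | T c.1 c.2 = i + 1} =
      (rowCount T 0 (i + 1) + rowCount T 1 (i + 1)) - (rowCount T 0 i + rowCount T 1 i) := by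
  have hrows : #{c ∈ (twoRows k).cells | T c.1 c.2 = i + 1} =
      #{j ∈ range k | T 0 j = i + 1} + #{j ∈ range k | T 1 j = i + 1} := by
    simp only [twoRows, card_filter, sum_product, sum_range_succ, sum_range_zero, zero_add]
  rw [hrows, rowCount_succ, rowCount_succ]
  omega

variable {T}

lemma HasContent.rowCount_add (hT : HasContent T a) (hk : a.sum = 2 * k) (i : ℕ) :
    rowCount T 0 i + rowCount T 1 i = (a.take i).sum := by
  have hshift : ∀ i ≤ a.length, rowCount T 0 i + rowCount T 1 i =
      (a.take i).sum + (rowCount T 0 0 + rowCount T 1 0) := fun i hi => by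
    induction i with
    | zero => simp
    | succ i ih =>
      have hstep := hT i hi
      rw [card_filter_eq_rowCount_sub] at hstep
      rw [List.sum_take_succ _ _ hi, ← hstep]
      have := rowCount_mono T 0 (Nat.le_add_right i 1)
      have := rowCount_mono T 1 (Nat.le_add_right i 1)
      have := ih (by omega)
      omega
  have htotal := hshift a.length le_rfl
  rw [List.take_length, hk] at htotal
  have hle := fun r i => rowCount_le T r i
  rcases le_total i a.length with hi | hi
  · have := hshift i hi
    have := hle 0 a.length
    have := hle 1 a.length
    omega
  · rw [List.take_of_length_le hi, hk]
    have := rowCount_mono T 0 hi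
    have := rowCount_mono T 1 hi
    have := hle 0 i
    have := hle 1 i
    omega

lemma hasContent_of_rowCount_add
    (h : ∀ i, rowCount T 0 i + rowCount T 1 i = (a.take i).sum) : HasContent T a := fun i hi => by
  rw [card_filter_eq_rowCount_sub, h, h, List.sum_take_succ _ _ hi, Nat.add_sub_cancel_left]

variable (T) in
/-- The list of multiplicities of `1, …, m` in the second row of a tableau. -/
def secondRow (m : ℕ) : List ℕ :=
  (List.range m).map fun i => rowCount T 1 (i + 1) - rowCount T 1 i

lemma HasContent.sum_take_secondRow (hT : HasContent T a) (hk : a.sum = 2 * k) (i : ℕ) :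
    ((secondRow T a.length).take i).sum = rowCount T 1 i := by
  induction i with
  | zero =>
    have := hT.rowCount_add hk 0
    rw [List.take_zero, List.sum_nil] at this ⊢
    omega
  | succ i ih =>
    have hmono := rowCount_mono T 1 (Nat.le_add_right i 1)
    rcases lt_or_ge i a.length with hi | hi
    · rw [List.sum_take_succ _ _ (by simpa [secondRow] using hi), ih]
      simp only [secondRow, List.getElem_map, List.getElem_range]
      omega
    · have hlen : (secondRow T a.length).length ≤ i := by simpa [secondRow] using hi
      rw [List.take_of_length_le hlen] at ih
      rw [List.take_of_length_le (by omega), ih]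
      have h0 := hT.rowCount_add hk i
      have h1 := hT.rowCount_add hk (i + 1)
      rw [List.take_of_length_le hi] at h0
      rw [List.take_of_length_le (by omega)] at h1
      have := rowCount_mono T 0 (Nat.le_add_right i 1)
      omega

lemma HasContent.secondRow_mem_fillings (hT : HasContent T a) (hk : a.sum = 2 * k) :
    secondRow T a.length ∈ fillings a 0 := by
  have hcount := hT.rowCount_add hk
  have hsecond := hT.sum_take_secondRow hk
  refine mem_fillings_iff.2 ⟨?_, fun i => ?_, ?_⟩
  · refine List.forall₂_iff_get.2 ⟨by simp [secondRow], fun i _ hi => ?_⟩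
    have h0 := hcount i
    have h1 := hcount (i + 1)
    rw [List.sum_take_succ _ _ hi] at h1
    have := rowCount_mono T 0 (Nat.le_add_right i 1)
    simp only [secondRow, List.get_eq_getElem, List.getElem_map, List.getElem_range]
    omega
  · rw [hsecond, hsecond, ← hcount i]
    have := rowCount_one_succ_le T i
    omega
  · have h2 := hsecond a.length
    rw [List.take_of_length_le (by simp [secondRow])] at h2
    have h0 := hcount a.length
    rw [List.take_length] at h0
    have := rowCount_le T 0 a.length
    have := rowCount_le T 1 a.length
    omega

/-- The numbers `c r i` of entries at most `i` in row `r`, as they occur in a tableau of shape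
`(k, k)`. -/
structure IsRowProfile (k : ℕ) (c : ℕ → ℕ → ℕ) : Prop where
  mono : ∀ r < 2, Monotone (c r)
  le : ∀ r < 2, ∀ i, c r i ≤ k
  exists_eq : ∀ r < 2, ∃ i, c r i = k
  one_zero : c 1 0 = 0
  one_succ_le : ∀ i, c 1 (i + 1) ≤ c 0 i

namespace IsRowProfile

variable {c : ℕ → ℕ → ℕ} (hc : IsRowProfile k c)
include hc

lemma lt_sInf {r j : ℕ} (hr : r < 2) (hj : j < k) : j < c r (sInf {i | j < c r i}) := by
  obtain ⟨m, hm⟩ := hc.exists_eq r hr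
  exact Nat.sInf_mem (s := {i | j < c r i}) ⟨m, show j < c r m by omega⟩

/-- The tableau with a given row profile: `j < c r i` if and only if the `j`-th entry of row `r` is
at most `i`. -/
noncomputable def toTableau : SemistandardYoungTableau (twoRows k) where
  entry r j := if r < 2 ∧ j < k then sInf {i | j < c r i} else 0
  row_weak' {r j j'} hj hcell := by
    obtain ⟨hr, hj'⟩ := mem_twoRows.1 hcell
    rw [if_pos ⟨hr, hj.trans hj'⟩, if_pos ⟨hr, hj'⟩]
    exact Nat.sInf_le (hj.trans (hc.lt_sInf hr hj'))
  col_strict' {r r' j} hr hcell := by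
    obtain ⟨hr', hj⟩ := mem_twoRows.1 hcell
    obtain rfl : r = 0 := by omega
    obtain rfl : r' = 1 := by omega
    rw [if_pos ⟨two_pos, hj⟩, if_pos ⟨one_lt_two, hj⟩]
    have hlt := hc.lt_sInf one_lt_two hj
    generalize sInf {i | j < c 1 i} = v at hlt ⊢
    cases v with
    | zero => simp [hc.one_zero] at hlt
    | succ v => exact Nat.lt_succ_of_le (Nat.sInf_le (hlt.trans_le (hc.one_succ_le v)))
  zeros' {r j} hcell := if_neg (mt mem_twoRows.2 hcell)

lemma rowCount_toTableau {r : ℕ} (hr : r < 2) (i : ℕ) : rowCount hc.toTableau r i = c r i := by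
  rw [rowCount, ← card_range (c r i)]
  congr 1
  ext j
  rw [mem_filter, mem_range, mem_range]
  constructor
  · rintro ⟨hj, hle⟩
    have hle : sInf {i | j < c r i} ≤ i := (if_pos ⟨hr, hj⟩).symm.trans_le hle
    exact (hc.lt_sInf hr hj).trans_le (hc.mono r hr hle)
  · intro hj
    have hjk := hj.trans_le (hc.le r hr i)
    exact ⟨hjk, (if_pos ⟨hr, hjk⟩).trans_le (Nat.sInf_le hj)⟩

end IsRowProfile

/-- The row profile of the tableau with content `a` and second-row multiplicities `s`. -/
def profile (a s : List ℕ) (r i : ℕ) : ℕ :=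
  if r = 0 then (a.take i).sum - (s.take i).sum else (s.take i).sum

lemma sum_take_le_of_mem_fillings {s : List ℕ} {h : ℕ} (hs : s ∈ fillings a h) (i : ℕ) :
    (s.take i).sum ≤ (a.take i).sum :=
  List.Forall₂.sum_le_sum (List.forall₂_take i (mem_fillings_iff.1 hs).1)

lemma isRowProfile_profile {s : List ℕ} (hk : a.sum = 2 * k) (hs : s ∈ fillings a 0) :
    IsRowProfile k (profile a s) := by
  obtain ⟨hle, hlattice, hsum⟩ := mem_fillings_iff.1 hs
  have hfull : ∀ r < 2, ∀ i, a.length ≤ i → profile a s r i = k := fun r _ i hi => by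
    rw [profile, List.take_of_length_le hi, List.take_of_length_le (hle.length_eq.trans_le hi)]
    split_ifs <;> omega
  have hmono : ∀ r < 2, Monotone (profile a s r) := fun r hr => by
    refine monotone_nat_of_le_succ fun i => ?_
    rcases lt_or_ge i a.length with hi | hi
    · have his : i < s.length := hle.length_eq ▸ hi
      have hget : s[i] ≤ a[i] := hle.get his hi
      simp only [profile, List.sum_take_succ _ _ hi, List.sum_take_succ _ _ his]
      have := sum_take_le_of_mem_fillings hs i
      split_ifs <;> omega
    · rw [hfull r hr i hi, hfull r hr (i + 1) (by omega)]
  exact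
    { mono := hmono
      le := fun r hr i => (hmono r hr (le_max_left i a.length)).trans_eq
        (hfull r hr _ (le_max_right i a.length))
      exists_eq := fun r hr => ⟨a.length, hfull r hr _ le_rfl⟩
      one_zero := by simp [profile]
      one_succ_le := fun i => by
        have := hlattice i
        simp only [profile, one_ne_zero, if_true, if_false]
        omega }

lemma exists_hasContent_secondRow_eq {s : List ℕ} (hk : a.sum = 2 * k) (hs : s ∈ fillings a 0) :
    ∃ T : SemistandardYoungTableau (twoRows k), HasContent T a ∧ secondRow T a.length = s := by
  have hc := isRowProfile_profile hk hs
  have htop := hc.rowCount_toTableau two_pos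
  have hbottom := hc.rowCount_toTableau one_lt_two
  simp only [profile, if_true, one_ne_zero, if_false] at htop hbottom
  have hT : HasContent hc.toTableau a := hasContent_of_rowCount_add fun i => by
    rw [htop, hbottom, Nat.sub_add_cancel (sum_take_le_of_mem_fillings hs i)]
  refine ⟨hc.toTableau, hT, List.eq_of_sum_take_eq ?_ fun i _ => ?_⟩
  · simpa [secondRow] using (mem_fillings_iff.1 hs).1.length_eq.symm
  · rw [hT.sum_take_secondRow hk, hbottom]

end Tableaux

lemma secondRow_bijOn {a : List ℕ} (ha : Even a.sum) :
    Set.BijOn (secondRow · a.length) (tableaux a) (fillings a 0) := by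
  have hk : a.sum = 2 * (ambientDim a - 1) := by
    obtain ⟨t, ht⟩ := ha
    rw [ambientDim]
    omega
  have hcontent : ∀ T ∈ tableaux a, HasContent T a := fun T hT i hi => hT ⟨i, hi⟩
  refine ⟨fun T hT => (hcontent T hT).secondRow_mem_fillings hk, fun T hT T' hT' h => ?_,
    fun s hs => ?_⟩
  · have hbottom : ∀ i, rowCount T 1 i = rowCount T' 1 i := fun i => by
      rw [← (hcontent T hT).sum_take_secondRow hk, ← (hcontent T' hT').sum_take_secondRow hk]
      exact congrArg (fun l : List ℕ => (l.take i).sum) h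
    refine tableau_ext fun r hr i => ?_
    have htop := (hcontent T hT).rowCount_add hk i
    have htop' := (hcontent T' hT').rowCount_add hk i
    have := hbottom i
    interval_cases r <;> omega
  · obtain ⟨T, hT, hTs⟩ := exists_hasContent_secondRow_eq hk hs
    exact ⟨T, fun i => hT i i.2, hTs⟩

lemma K_eq_mult {a : List ℕ} (ha : Even a.sum) : K a = mult a 0 := by
  rw [K, (secondRow_bijOn ha).ncard_eq, Set.ncard_coe_finset, card_fillings]

/-- The product of a function on `ℤ` with the character of the irreducible `SL₂`-module of highest
weight `x`. Functions on `ℤ` are thought of as Weyl numerators `∑ f(m) z ^ m`, the argument `m`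
being a highest weight plus one, so that Weyl antisymmetry is oddness. -/
def charMul (x : ℕ) : (ℤ → ℚ) →ₗ[ℚ] ℤ → ℚ :=
  ∑ q ∈ range (x + 1), LinearMap.funLeft ℚ ℚ fun m : ℤ => m + x - 2 * q

lemma charMul_apply (x : ℕ) (f : ℤ → ℚ) (m : ℤ) :
    charMul x f m = ∑ q ∈ range (x + 1), f (m + x - 2 * q) := by
  simp [charMul, LinearMap.funLeft_apply]

lemma charMul_comm (x y : ℕ) (f : ℤ → ℚ) :
    charMul x (charMul y f) = charMul y (charMul x f) := by
  ext m
  simp only [charMul_apply]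
  rw [sum_comm]
  exact sum_congr rfl fun q _ => sum_congr rfl fun r _ => congrArg f (by ring)

lemma charMul_zero (f : ℤ → ℚ) : charMul 0 f = f := by
  ext m
  simp [charMul_apply]

lemma charMul_succ (x : ℕ) (f : ℤ → ℚ) (m : ℤ) :
    charMul (x + 1) f m = charMul x f (m + 1) + f (m - x - 1) := by
  rw [charMul_apply, charMul_apply, sum_range_succ]
  congr 1
  · exact sum_congr rfl fun q _ => congrArg f (by push_cast; ring)
  · exact congrArg f (by push_cast; ring)

lemma charMul_succ' (x : ℕ) (f : ℤ → ℚ) (m : ℤ) :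
    charMul (x + 1) f m = f (m + x + 1) + charMul x f (m - 1) := by
  rw [charMul_apply, charMul_apply, sum_range_succ', add_comm]
  congr 1
  · exact congrArg f (by push_cast; ring)
  · exact sum_congr rfl fun q _ => congrArg f (by push_cast; ring)

lemma charMul_two (f : ℤ → ℚ) (m : ℤ) : charMul 2 f m = f (m - 2) + f m + f (m + 2) := by
  rw [charMul_succ, charMul_succ, charMul_zero]
  push_cast
  ring_nf

lemma charMul_add_add_one (x y : ℕ) (f : ℤ → ℚ) (m : ℤ) :
    charMul (x + y + 1) f m = charMul x f (m + y + 1) + charMul y f (m - x - 1) := by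
  simp only [charMul_apply]
  rw [show x + y + 1 + 1 = (x + 1) + (y + 1) by ring, sum_range_add]
  congr 1 <;> exact sum_congr rfl fun q _ => congrArg f (by push_cast; ring)

lemma charMul_succ_succ (x y : ℕ) (f : ℤ → ℚ) :
    charMul (x + 1) (charMul (y + 1) f) = charMul (x + y + 2) f + charMul x (charMul y f) := by
  ext m
  have hsplit : charMul (x + 1) (charMul (y + 1) f) m =
      charMul (x + 1) f (m + y + 1) + charMul (x + 1) (charMul y f) (m - 1) := by
    simp only [charMul_apply (x + 1), charMul_succ' y f, ← sum_add_distrib]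
    exact sum_congr rfl fun q _ =>
      congrArg₂ (· + ·) (congrArg f (by push_cast; ring)) (congrArg _ (by ring))
  rw [hsplit, charMul_succ x (charMul y f), Pi.add_apply, show x + y + 2 = x + 1 + y + 1 by ring,
    charMul_add_add_one, sub_add_cancel, Nat.cast_add_one]
  ring_nf

lemma charMul_charMul_self (t : ℕ) (f : ℤ → ℚ) :
    charMul t (charMul t f) = ∑ i ∈ range (t + 1), charMul (2 * i) f := by
  induction t with
  | zero => simp [charMul_zero]
  | succ t ih =>
    rw [charMul_succ_succ, ih, sum_range_succ _ (t + 1), add_comm]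
    congr 2
    ring_nf

lemma odd_charMul {f : ℤ → ℚ} (hf : f.Odd) (x : ℕ) : (charMul x f).Odd := fun m => by
  rw [charMul_apply, charMul_apply, ← sum_range_reflect, ← sum_neg_distrib]
  refine sum_congr rfl fun q hq => ?_
  rw [← hf, Nat.add_sub_cancel, Nat.cast_sub (mem_range_succ_iff.1 hq)]
  exact congrArg f (by ring)

lemma charMul_eq_zero_of_le {f : ℤ → ℚ} {M : ℤ} (hf : ∀ m, M ≤ m → f m = 0) {x : ℕ} {m : ℤ}
    (hm : M + x ≤ m) : charMul x f m = 0 := by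
  rw [charMul_apply]
  refine sum_eq_zero fun q hq => hf _ ?_
  have := mem_range_succ_iff.1 hq
  omega

lemma eventually_charMul_eq_zero {f : ℤ → ℚ} (hf : ∀ᶠ m in atTop, f m = 0) (x : ℕ) :
    ∀ᶠ m in atTop, charMul x f m = 0 := by
  obtain ⟨M, hM⟩ := eventually_atTop.1 hf
  exact eventually_atTop.2 ⟨M + x, fun _ => charMul_eq_zero_of_le hM⟩

lemma charMul_natCast_add_one {f : ℤ → ℚ} (hf : f.Odd) (x h : ℕ) :
    charMul x f (h + 1) = ∑ q ∈ range (min h x + 1), f (h + 1 + x - 2 * q) := by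
  rcases le_or_gt x h with hx | hx
  · rw [charMul_apply, min_eq_right hx]
  · obtain ⟨n, rfl⟩ := Nat.exists_eq_add_of_lt hx
    have hcancel : charMul n f (h + 1 - h - 1) = 0 := by
      rw [add_sub_cancel_left, sub_self]
      exact (odd_charMul hf n).map_zero
    rw [min_eq_left hx.le, charMul_add_add_one, hcancel, add_zero, charMul_apply]
    exact sum_congr rfl fun q _ => congrArg f (by push_cast; ring)

/-- The Weyl numerator of the irreducible `SL₂`-module of dimension `p`. -/
def numer (p : ℤ) : ℤ → ℚ := Pi.single p 1 - Pi.single (-p) 1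

lemma odd_numer (p : ℤ) : (numer p).Odd := fun m => by
  simp only [numer, Pi.sub_apply, Pi.single_apply, neg_inj, neg_eq_iff_eq_neg (b := p), neg_sub]

/-- The Weyl numerator of the tensor product of the irreducible `SL₂`-modules whose highest weights
are the entries of the list. -/
def weylNumerator (l : List ℕ) : ℤ → ℚ := l.foldr (fun x => charMul x) (numer 1)

lemma weylNumerator_cons (x : ℕ) (l : List ℕ) :
    weylNumerator (x :: l) = charMul x (weylNumerator l) := rfl

lemma weylNumerator_perm {l l' : List ℕ} (h : l.Perm l') : weylNumerator l = weylNumerator l' :=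
  haveI : LeftCommutative fun x : ℕ => (charMul x : (ℤ → ℚ) → ℤ → ℚ) := ⟨charMul_comm⟩
  h.foldr_eq _

lemma odd_weylNumerator (l : List ℕ) : (weylNumerator l).Odd := by
  induction l with
  | nil => exact odd_numer 1
  | cons x l ih => exact odd_charMul ih x

lemma mult_eq_weylNumerator (l : List ℕ) (h : ℕ) : (mult l h : ℚ) = weylNumerator l (h + 1) := by
  induction l generalizing h with
  | nil =>
    have : (h : ℤ) + 1 ≠ -1 := by omega
    simp [mult, weylNumerator, numer, Pi.single_apply, this]
  | cons x l ih =>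
    rw [weylNumerator_cons, charMul_natCast_add_one (odd_weylNumerator l), mult, Nat.cast_sum]
    refine sum_congr rfl fun q hq => ?_
    have := mem_range_succ_iff.1 hq
    rw [ih]
    exact congrArg _ (by omega)

lemma eventually_numer_eq_zero (p : ℤ) : ∀ᶠ m in atTop, numer p m = 0 := by
  filter_upwards [eventually_gt_atTop |p|] with m hm
  have hp := le_abs_self p
  have hp' := neg_le_abs p
  simp [numer, show m ≠ p by omega, show m ≠ -p by omega]

lemma eventually_weylNumerator_eq_zero (l : List ℕ) :
    ∀ᶠ m in atTop, weylNumerator l m = 0 := by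
  induction l with
  | nil => exact eventually_numer_eq_zero 1
  | cons x l ih => exact eventually_charMul_eq_zero ih x

lemma charMul_numer_one (t : ℕ) : charMul t (numer 1) = numer (t + 1) := by
  induction t with
  | zero => simp [charMul_zero]
  | succ t ih =>
    ext m
    rw [charMul_succ, ih]
    simp only [numer, Pi.sub_apply, Pi.single_apply, sub_eq_iff_eq_add, ← eq_sub_iff_add_eq]
    push_cast
    ring_nf

lemma mult_perm {l l' : List ℕ} (h : l.Perm l') (k : ℕ) : mult l k = mult l' k := by
  have := congrFun (weylNumerator_perm h) (k + 1)
  rwa [← mult_eq_weylNumerator, ← mult_eq_weylNumerator, Nat.cast_inj] at this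
/-- The functions `f` for which `f(m) / m` is weakly decreasing along each parity class of positive
integers. The odd ones are the Weyl numerators that behave like radially decreasing densities on
`ℝ³ = su(2)*`. -/
def radialCone : PointedCone ℚ (ℤ → ℚ) where
  carrier := {f | ∀ k : ℕ, k * f (k + 2) ≤ (k + 2) * f k}
  add_mem' hf hg k := by
    have := hf k
    have := hg k
    simp only [Pi.add_apply]
    linarith
  zero_mem' k := by simp
  smul_mem' c f hf k := by
    have := mul_le_mul_of_nonneg_left (hf k) c.2
    change k * (c * f (k + 2)) ≤ (k + 2) * (c * f k)
    linarith

lemma mem_radialCone {f : ℤ → ℚ} :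
    f ∈ radialCone ↔ ∀ k : ℕ, k * f (k + 2) ≤ (k + 2) * f k :=
  Iff.rfl

lemma mul_apply_add_le_of_mem_radialCone {f : ℤ → ℚ} (hf : f ∈ radialCone) {k : ℕ} (hk : 0 < k)
    (n : ℕ) : k * f (k + 2 * n) ≤ (k + 2 * n) * f k := by
  induction n with
  | zero => simp
  | succ n ih =>
    have hstep := mem_radialCone.1 hf (k + 2 * n)
    push_cast at hstep ⊢
    rw [show (k : ℤ) + 2 * (n + 1) = k + 2 * n + 2 by ring]
    refine le_of_mul_le_mul_left ?_ (by positivity : (0 : ℚ) < k + 2 * n)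
    have := mul_le_mul_of_nonneg_left hstep (Nat.cast_nonneg (α := ℚ) k)
    have := mul_le_mul_of_nonneg_left ih (by positivity : (0 : ℚ) ≤ k + 2 * n + 2)
    linarith

/-- The Weyl numerator proportional to `m` on the points of `[-r, r]` of the same parity as `r`:
an extremal radially decreasing function. -/
def ball (r : ℕ) (m : ℤ) : ℚ := if |m| ≤ r ∧ 2 ∣ m - r then m else 0

lemma odd_ball (r : ℕ) : (ball r).Odd := fun m => by
  have : (2 : ℤ) ∣ -m - r ↔ 2 ∣ m - r := by omega
  simp only [ball, abs_neg, this]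
  split_ifs <;> simp

lemma ball_of_lt {r : ℕ} {m : ℤ} (hm : r < m) : ball r m = 0 :=
  if_neg fun h => (le_abs_self m).not_gt (h.1.trans_lt hm)

lemma ball_zero : ball 0 = 0 := by
  ext m
  simp only [ball, Pi.zero_apply, ite_eq_right_iff, and_imp]
  rintro hm -
  simpa using hm

lemma ball_self (r : ℕ) : ball r r = r := by
  simp [ball]

lemma ball_one : ball 1 = numer 1 := by
  ext m
  simp only [ball, numer, Pi.sub_apply, Pi.single_apply, abs_le]
  have hcast : m = -1 → (m : ℚ) = -1 := fun h => by exact_mod_cast h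
  have hcast' : m = 1 → (m : ℚ) = 1 := fun h => by exact_mod_cast h
  grind

lemma ball_add_two (r : ℕ) : ball (r + 2) = ball r + ((r : ℚ) + 2) • numer (r + 2) := by
  ext m
  simp only [ball, numer, Pi.add_apply, Pi.smul_apply, Pi.sub_apply, Pi.single_apply, abs_le,
    smul_eq_mul, Nat.cast_add, Nat.cast_ofNat]
  have hcast : m = r + 2 → (m : ℚ) = r + 2 := fun h => by exact_mod_cast h
  have hcast' : m = -(r + 2) → (m : ℚ) = -(r + 2) := fun h => by exact_mod_cast h
  grind

lemma charMul_single (x : ℕ) (p m : ℤ) :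
    charMul x (Pi.single p 1) m = if |m - p| ≤ x ∧ 2 ∣ m - p - x then 1 else 0 := by
  induction x generalizing m with
  | zero =>
    rw [charMul_zero, Pi.single_apply]
    grind
  | succ x ih =>
    rw [charMul_succ, ih, Pi.single_apply]
    push_cast
    grind

/-- The coefficients of the square of the character of the irreducible `SL₂`-module of highest
weight `t`: a triangular function on the even integers. -/
def tent (t : ℕ) (m : ℤ) : ℤ := if 2 ∣ m then max 0 (t + 1 - |m| / 2) else 0

lemma charMul_charMul_single (t : ℕ) (p m : ℤ) :
    charMul t (charMul t (Pi.single p 1)) m = tent t (m - p) := by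
  rw [charMul_charMul_self, Finset.sum_apply]
  induction t with
  | zero =>
    have hzero : tent 0 (m - p) = if m = p then 1 else 0 := by
      rw [tent]
      rcases abs_cases (m - p) with ⟨h, _⟩ | ⟨h, _⟩ <;> rw [h] <;> split_ifs <;> omega
    rw [zero_add, sum_range_one, mul_zero, charMul_zero, Pi.single_apply, hzero]
    push_cast
    rfl
  | succ t ih =>
    have hstep : tent (t + 1) (m - p) = tent t (m - p) +
        if |m - p| ≤ (2 * (t + 1) : ℕ) ∧ 2 ∣ m - p - (2 * (t + 1) : ℕ) then 1 else 0 := by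
      simp only [tent]
      push_cast
      grind
    rw [sum_range_succ, ih, charMul_single, hstep]
    push_cast
    rfl

lemma charMul_charMul_numer (t : ℕ) (p m : ℤ) :
    charMul t (charMul t (numer p)) m = tent t (m - p) - tent t (m + p) := by
  rw [numer, map_sub, map_sub, Pi.sub_apply, charMul_charMul_single, charMul_charMul_single,
    sub_neg_eq_add]

lemma two_mul_tent_sub_tent {t : ℕ} {k p : ℤ} (hk : 0 ≤ k) (hp : 0 ≤ p) (hpt : p ≤ 2 * t + 1)
    (hpar : 2 ∣ k - p) :
    2 * (tent t (k - p) - tent t (k + p)) =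
      min (min (2 * k) (2 * p)) (min (2 * t + 2 - p + k) (max 0 (2 * t + 2 + p - k))) := by
  rw [tent, tent, if_pos hpar, if_pos (by omega), abs_of_nonneg (by positivity : 0 ≤ k + p)]
  rcases abs_cases (k - p) with ⟨h, _⟩ | ⟨h, _⟩ <;> rw [h] <;> omega

lemma charMul_charMul_numer_mem_radialCone {t p : ℕ} (hp : p ≤ 2 * t + 1) :
    charMul t (charMul t (numer p)) ∈ radialCone := by
  refine mem_radialCone.2 fun k => ?_
  rw [charMul_charMul_numer, charMul_charMul_numer]
  suffices (k : ℤ) * (tent t (k + 2 - p) - tent t (k + 2 + p)) ≤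
      (k + 2) * (tent t (k - p) - tent t (k + p)) by exact_mod_cast this
  by_cases hpar : (2 : ℤ) ∣ k - p
  · have hk := two_mul_tent_sub_tent (t := t) k.cast_nonneg p.cast_nonneg (by omega) hpar
    have hk' := two_mul_tent_sub_tent (t := t) (k := k + 2) (p := p) (by positivity)
      p.cast_nonneg (by omega) (by omega)
    generalize tent t (k - p) - tent t (k + p) = X at *
    generalize tent t (k + 2 - p) - tent t (k + 2 + p) = X' at *
    have hX' : X' ≤ k + 2 ∧ X' ≤ p ∧ 2 * X' ≤ 2 * t + 2 - p + k + 2 ∧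
        2 * X' ≤ max 0 (2 * t + 2 + p - k : ℤ) := by omega
    have hX : X = k ∨ X = p ∨ 2 * X = 2 * t + 2 - p + k ∨
        2 * X = max 0 (2 * t + 2 + p - k : ℤ) := by omega
    have hX0 : 0 ≤ X := by omega
    obtain ⟨h₁, h₂, h₃, h₄⟩ := hX'
    rcases hX with rfl | rfl | h | h
    · nlinarith
    · nlinarith
    · nlinarith
    · nlinarith
  · have hpar' : ∀ m : ℤ, m = k - p ∨ m = k + p ∨ m = k + 2 - p ∨ m = k + 2 + p → ¬ 2 ∣ m := by
      omega
    simp [tent, hpar']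

lemma charMul_ball_of_abs_add_le {x r : ℕ} {m : ℤ} (hm : |m| + x ≤ r) (hpar : 2 ∣ m + x - r) :
    charMul x (ball r) m = (x + 1) * m := by
  induction x generalizing m with
  | zero =>
    rw [charMul_zero, ball, if_pos (by constructor <;> grind)]
    simp
  | succ x ih =>
    rw [charMul_succ, ih (by grind) (by grind), ball, if_pos (by constructor <;> grind)]
    push_cast
    ring

lemma charMul_ball_of_le_add {x r : ℕ} (hx : x ≤ r) {m : ℤ} (hle : r ≤ m + x)
    (hge : m ≤ r + x + 2) (hpar : 2 ∣ m + x - r) :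
    charMul x (ball r) m = (r + x + 2 - m) * (r + m - x) / 4 := by
  induction x generalizing m with
  | zero =>
    rw [charMul_zero]
    obtain rfl | rfl : m = r ∨ m = r + 2 := by grind
    · rw [ball_self]
      push_cast
      ring
    · rw [ball_of_lt (by omega)]
      simp
  | succ x ih =>
    rw [charMul_succ]
    obtain hm | rfl : m ≤ r + x + 1 ∨ m = r + x + 3 := by grind
    · rw [ih (by omega) (by grind) (by omega) (by grind), ball, if_pos (by constructor <;> grind)]
      push_cast
      ring
    · rw [charMul_eq_zero_of_le (M := r + 1) (fun _ h => ball_of_lt h) (by omega),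
        ball_of_lt (by omega)]
      push_cast
      ring

lemma charMul_ball_of_not_dvd {x r : ℕ} {m : ℤ} (hpar : ¬ 2 ∣ m + x - r) :
    charMul x (ball r) m = 0 := by
  rw [charMul_apply]
  exact sum_eq_zero fun q _ => if_neg fun h => hpar (by omega)

lemma charMul_ball_of_lt {x r : ℕ} {m : ℤ} (hm : r + x < m) : charMul x (ball r) m = 0 :=
  charMul_eq_zero_of_le (fun _ h => ball_of_lt (Int.lt_of_add_one_le h)) (by omega)

lemma charMul_ball_mem_radialCone {x r : ℕ} (hx : x ≤ r) : charMul x (ball r) ∈ radialCone := by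
  refine mem_radialCone.2 fun k => ?_
  by_cases hpar : (2 : ℤ) ∣ k + x - r
  swap
  · rw [charMul_ball_of_not_dvd hpar, charMul_ball_of_not_dvd (by omega), mul_zero, mul_zero]
  have hpar' : (2 : ℤ) ∣ k + 2 + x - r := by omega
  rcases le_or_gt ((k : ℤ) + 2 + x) r with hin | hout
  · rw [charMul_ball_of_abs_add_le (by grind) hpar, charMul_ball_of_abs_add_le (by grind) hpar']
    push_cast
    exact le_of_eq (by ring)
  rcases le_or_gt k (r + x) with hk | hk
  · rw [charMul_ball_of_le_add hx (by omega) (by omega) hpar,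
      charMul_ball_of_le_add hx (by omega) (by omega) hpar']
    have hk₀ : (0 : ℚ) ≤ k := k.cast_nonneg
    have hxr : (0 : ℚ) ≤ r - x := sub_nonneg.2 (mod_cast hx)
    have hkrx : (0 : ℚ) ≤ r + x - k := sub_nonneg.2 (mod_cast hk)
    push_cast
    nlinarith [mul_nonneg hkrx hxr, mul_nonneg hk₀ hxr, mul_nonneg hk₀ hk₀]
  · rw [charMul_ball_of_lt (by omega), charMul_ball_of_lt (by omega), mul_zero, mul_zero]

lemma charMul_charMul_ball_mem_radialCone (t r : ℕ) :
    charMul t (charMul t (ball r)) ∈ radialCone := by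
  rcases le_or_gt r (2 * t + 1) with hr | hr
  · induction r using Nat.twoStepInduction with
    | zero => simp [ball_zero]
    | one => exact ball_one ▸ charMul_charMul_numer_mem_radialCone hr
    | more r ih _ =>
      rw [ball_add_two, map_add, map_add, map_smul, map_smul]
      exact add_mem (ih (by omega))
        (radialCone.smul_mem (by positivity)
          (by exact_mod_cast charMul_charMul_numer_mem_radialCone hr))
  · rw [charMul_charMul_self]
    refine sum_mem fun i hi => charMul_ball_mem_radialCone ?_
    have := mem_range_succ_iff.1 hi
    omega

lemma mul_ball_add_two {k r : ℕ} (hk : k < r) : k * ball r (k + 2) = (k + 2) * ball r k := by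
  simp only [ball, abs_of_nonneg (by positivity : (0 : ℤ) ≤ k + 2), Nat.abs_cast]
  by_cases hpar : (2 : ℤ) ∣ k - r
  · rw [if_pos (by omega), if_pos (by omega)]
    push_cast
    ring
  · rw [if_neg (by omega), if_neg (by omega), mul_zero, mul_zero]

lemma sub_smul_ball_mem_radialCone {f : ℤ → ℚ} (hf : f ∈ radialCone) {M : ℕ}
    (hM : ∀ m : ℤ, (M + 1 : ℕ) ≤ m → f m = 0) {c : ℚ} (hc : c * M = f M) :
    f - c • ball M ∈ radialCone := by
  refine mem_radialCone.2 fun k => ?_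
  simp only [Pi.sub_apply, Pi.smul_apply, smul_eq_mul]
  rcases lt_trichotomy k M with hk | rfl | hk
  · linear_combination mem_radialCone.1 hf k - c * mul_ball_add_two hk
  · rw [hM (k + 2) (by omega), ball_of_lt (by omega), ball_self, hc]
    simp
  · rw [hM k (by omega), hM (k + 2) (by omega), ball_of_lt (by omega), ball_of_lt (by omega)]
    simp

lemma mem_hull_range_ball {f : ℤ → ℚ} (hf : f ∈ radialCone) (hodd : f.Odd)
    (hzero : ∀ᶠ m in atTop, f m = 0) : f ∈ PointedCone.hull ℚ (Set.range ball) := by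
  obtain ⟨M, hM⟩ : ∃ M : ℕ, ∀ m : ℤ, M ≤ m → f m = 0 := by
    obtain ⟨M, hM⟩ := eventually_atTop.1 hzero
    exact ⟨M.toNat, fun m hm => hM m (by omega)⟩
  clear hzero
  induction M generalizing f with
  | zero =>
    have hf0 : f = 0 := by
      ext m
      rcases le_total 0 m with hm | hm
      · exact hM m hm
      · rw [← neg_neg m, hodd, hM (-m) (by simpa using hm), neg_zero, Pi.zero_apply]
    exact hf0 ▸ zero_mem _
  | succ M ih =>
    set c : ℚ := f M / M
    have hcM : c * M = f M := by
      rcases eq_or_ne (M : ℚ) 0 with h0 | h0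
      · have : (M : ℤ) = 0 := by exact_mod_cast h0
        rw [h0, mul_zero, this, hodd.map_zero]
      · exact div_mul_cancel₀ _ h0
    have hc0 : 0 ≤ c := by
      have := mem_radialCone.1 hf M
      rw [hM _ (by push_cast; omega), mul_zero] at this
      exact div_nonneg (nonneg_of_mul_nonneg_right this (by positivity)) (Nat.cast_nonneg M)
    have hsub : f - c • ball M ∈ PointedCone.hull ℚ (Set.range ball) := by
      refine ih (sub_smul_ball_mem_radialCone hf hM hcM) ?_ fun m hm => ?_
      · intro m
        simp only [Pi.sub_apply, Pi.smul_apply, smul_eq_mul, hodd m, odd_ball M m]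
        ring
      · rw [Pi.sub_apply, Pi.smul_apply, smul_eq_mul]
        obtain rfl | hm := hm.eq_or_lt
        · rw [ball_self, hcM, sub_self]
        · rw [ball_of_lt hm, hM m (by push_cast; omega), mul_zero, sub_zero]
    rw [← sub_add_cancel f (c • ball M)]
    exact add_mem hsub (PointedCone.smul_mem _ hc0 (PointedCone.subset_hull ⟨M, rfl⟩))

lemma charMul_charMul_mem_radialCone {f : ℤ → ℚ} (hf : f ∈ radialCone) (hodd : f.Odd)
    (hzero : ∀ᶠ m in atTop, f m = 0) (t : ℕ) : charMul t (charMul t f) ∈ radialCone := by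
  have hle : PointedCone.hull ℚ (Set.range ball) ≤
      radialCone.comap (charMul t ∘ₗ charMul t) :=
    Submodule.span_le.2 <| Set.range_subset_iff.2 <| charMul_charMul_ball_mem_radialCone t
  exact hle (mem_hull_range_ball hf hodd hzero)

lemma weylNumerator_replicate_mem_radialCone (t : ℕ) {n : ℕ} (hn : 2 ≤ n) :
    weylNumerator (List.replicate n t) ∈ radialCone := by
  obtain ⟨n, rfl⟩ := Nat.exists_eq_add_of_le' hn
  induction n using Nat.twoStepInduction with
  | zero => exact charMul_charMul_numer_mem_radialCone (p := 1) (by omega)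
  | one =>
    change charMul t (charMul t (charMul t (numer 1))) ∈ radialCone
    rw [charMul_numer_one]
    exact_mod_cast charMul_charMul_numer_mem_radialCone (p := t + 1) (by omega)
  | more n ih _ =>
    exact charMul_charMul_mem_radialCone (ih (by omega)) (odd_weylNumerator _)
      (eventually_weylNumerator_eq_zero _) t

lemma lt_sum_of_mem_radialCone {f : ℤ → ℚ} (hf : f ∈ radialCone) {t : ℕ} (ht : 3 ≤ t)
    (hpos : 0 < f (2 * t + 1)) : f (2 * t + 1) < ∑ i ∈ range t, f (2 * i + 1) := by
  have hterm : ∀ i ∈ range t, (2 * i + 1) * f (2 * t + 1) ≤ (2 * t + 1) * f (2 * i + 1) := by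
    intro i hi
    obtain ⟨j, rfl⟩ := Nat.exists_eq_add_of_lt (mem_range.1 hi)
    have h := mul_apply_add_le_of_mem_radialCone hf (Nat.succ_pos (2 * i)) (j + 1)
    convert h using 2 <;> push_cast <;> ring_nf
  have hodd : ∑ i ∈ range t, (2 * i + 1 : ℚ) = t ^ 2 := by
    clear * -
    induction t with
    | zero => simp
    | succ t ih =>
      rw [sum_range_succ, ih]
      push_cast
      ring
  have ht' : (3 : ℚ) ≤ t := mod_cast ht
  refine lt_of_mul_lt_mul_left ?_ (by positivity : (0 : ℚ) ≤ 2 * t + 1)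
  calc (2 * t + 1) * f (2 * t + 1) < t ^ 2 * f (2 * t + 1) := by gcongr; nlinarith
    _ = ∑ i ∈ range t, (2 * i + 1) * f (2 * t + 1) := by rw [← hodd, sum_mul]
    _ ≤ ∑ i ∈ range t, (2 * t + 1) * f (2 * i + 1) := sum_le_sum hterm
    _ = (2 * t + 1) * ∑ i ∈ range t, f (2 * i + 1) := by rw [mul_sum]

lemma mult_pos {l : List ℕ} {h : ℕ} (heven : Even (h + l.sum)) (hle : h ≤ l.sum)
    (hmem : ∀ x ∈ l, 2 * x ≤ h + l.sum) : 0 < mult l h := by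
  induction l generalizing h with
  | nil =>
    obtain rfl : h = 0 := by simpa using hle
    simp [mult]
  | cons x l ih =>
    rw [List.forall_mem_cons] at hmem
    rw [List.sum_cons] at heven hle hmem
    obtain ⟨s, hs⟩ := heven
    obtain ⟨q, hqh, hqx, hq⟩ :
        ∃ q, q ≤ h ∧ q ≤ x ∧ h + x - 2 * q = min (h + x) l.sum :=
      ⟨(h + x - min (h + x) l.sum) / 2, by omega, by omega, by omega⟩
    have hpos : 0 < mult l (h + x - 2 * q) := by
      refine ih ⟨s - q, by omega⟩ (hq ▸ min_le_right _ _) fun y hy => ?_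
      have := hmem.2 y hy
      have := List.le_sum_of_mem hy
      omega
    exact sum_pos' (fun _ _ => Nat.zero_le _) ⟨q, mem_range_succ_iff.2 (le_min hqh hqx), hpos⟩

lemma mult_replicate_pos {n t h : ℕ} (heven : Even (h + n * t)) (hle : h ≤ n * t)
    (ht : 2 * t ≤ h + n * t) : 0 < mult (List.replicate n t) h := by
  have hsum : (List.replicate n t).sum = n * t := by simp
  exact mult_pos (hsum ▸ heven) (hsum ▸ hle) fun x hx =>
    hsum ▸ List.eq_of_mem_replicate hx ▸ ht

lemma mult_zero_cons (x : ℕ) (l : List ℕ) : mult (x :: l) 0 = mult l x := by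
  simp [mult]

lemma mult_append_singleton (b : List ℕ) (x : ℕ) : mult (b ++ [x]) 0 = mult b x := by
  rw [mult_perm (List.perm_append_singleton x b), mult_zero_cons]

lemma mult_append_pair (b : List ℕ) (x y : ℕ) :
    mult (b ++ [x, y]) 0 = ∑ q ∈ range (min x y + 1), mult b (x + y - 2 * q) := by
  rw [mult_perm List.perm_append_comm, List.cons_append, List.singleton_append, mult_zero_cons]
  rfl

lemma mult_clebschGordan (b : List ℕ) {x y : ℕ} (hx : 0 < x) (hy : 0 < y) :
    mult (b ++ [x, y]) 0 = mult (b ++ [x + y]) 0 + mult (b ++ [x - 1, y - 1]) 0 := by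
  rw [mult_append_pair, mult_append_pair, mult_append_singleton, sum_range_succ', add_comm,
    show min x y = min (x - 1) (y - 1) + 1 by omega]
  exact congrArg _ (sum_congr rfl fun q _ => congrArg _ (by omega))

lemma isReduced_iff_pairwise {a : List ℕ} :
    IsReduced a ↔ IsSchubertProblem a ∧ a.Pairwise fun x y => x + y < ambientDim a := by
  rw [IsReduced, List.pairwise_iff_get]

lemma IsReduced.perm {a b : List ℕ} (ha : IsReduced a) (h : a.Perm b) : IsReduced b := by
  rw [isReduced_iff_pairwise, IsSchubertProblem, ambientDim] at ha ⊢
  have hsymm : ∀ {x y : ℕ}, x + y < (a.sum + 2) / 2 → y + x < (a.sum + 2) / 2 := by omega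
  rw [← h.sum_eq, ← h.pairwise_iff hsymm]
  exact ⟨⟨fun x hx => ha.1.1 x (h.mem_iff.2 hx), ha.1.2⟩, ha.2⟩

lemma IsReduced.exists_pairwise_add_le {a : List ℕ} (ha : IsReduced a) :
    ∃ s, a.sum = 2 * s ∧ a.Pairwise fun x y => x + y ≤ s := by
  obtain ⟨⟨-, hsum⟩, hpair⟩ := isReduced_iff_pairwise.1 ha
  obtain ⟨s, hs⟩ := hsum.two_dvd
  exact ⟨s, hs, hpair.imp fun h => by rw [ambientDim] at h; omega⟩

lemma IsReduced.mult_merge_pos {b : List ℕ} {x y : ℕ} (h : IsReduced (b ++ [x, y])) :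
    0 < mult (b ++ [x + y]) 0 := by
  obtain ⟨s, hs, hpair⟩ := h.exists_pairwise_add_le
  obtain ⟨-, hxy, hb⟩ := List.pairwise_append.1 hpair
  have hxy : x + y ≤ s := by simpa using hxy
  have hs : b.sum + (x + y) = 2 * s := by simpa using hs
  rw [mult_append_singleton]
  refine mult_pos ⟨s, by omega⟩ (by omega) fun z hz => ?_
  have := hb z hz x (by simp)
  omega

lemma IsReduced.mult_lower_pos {b : List ℕ} {x y : ℕ} (h : IsReduced (b ++ [x, y])) :
    0 < mult (b ++ [x - 1, y - 1]) 0 := by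
  obtain ⟨s, hs, hpair⟩ := h.exists_pairwise_add_le
  obtain ⟨-, hxy, hb⟩ := List.pairwise_append.1 hpair
  have hxy : x + y ≤ s := by simpa using hxy
  have hx : 0 < x := h.1.1 x (by simp)
  have hy : 0 < y := h.1.1 y (by simp)
  have hs : b.sum + (x + y) = 2 * s := by simpa using hs
  have hsum : (b ++ [x - 1, y - 1]).sum = 2 * (s - 1) := by
    simp only [List.sum_append, List.sum_cons, List.sum_nil]
    omega
  refine mult_pos ⟨s - 1, by omega⟩ (Nat.zero_le _) fun z hz => ?_
  rw [hsum]
  rcases List.mem_append.1 hz with hz | hz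
  · have := hb z hz x (by simp)
    omega
  · have : z = x - 1 ∨ z = y - 1 := by simpa using hz
    omega

lemma IsReduced.mult_merge_lt {c : List ℕ} {x y z : ℕ} (h : IsReduced (c ++ [x, y, z]))
    (hyz : y < z) : mult (c ++ [y, x + z]) 0 < mult (c ++ [z, x + y]) 0 := by
  obtain ⟨s, hs, hpair⟩ := h.exists_pairwise_add_le
  obtain ⟨-, hxyz, hc⟩ := List.pairwise_append.1 hpair
  have hxyz : (x + y ≤ s ∧ x + z ≤ s) ∧ y + z ≤ s := by simpa using hxyz
  have hx : 0 < x := h.1.1 x (by simp)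
  have hs : c.sum + (x + (y + z)) = 2 * s := by simpa using hs
  rw [mult_append_pair, mult_append_pair, show y + (x + z) = z + (x + y) by ring]
  obtain ⟨q, hyq, hqz, hqxy, hq⟩ :
      ∃ q, y < q ∧ q ≤ z ∧ q ≤ x + y ∧ z + (x + y) - 2 * q = min (x + z - y - 2) c.sum :=
    ⟨(z + (x + y) - min (x + z - y - 2) c.sum) / 2, by omega, by omega, by omega, by omega⟩
  have hpos : 0 < mult c (z + (x + y) - 2 * q) := by
    refine mult_pos ⟨s - q, by omega⟩ (hq ▸ min_le_right _ _) fun w hw => ?_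
    have := hc w hw z (by simp)
    have := List.le_sum_of_mem hw
    omega
  exact sum_lt_sum_of_subset (range_mono (by omega)) (mem_range.2 (by omega))
    (by rw [mem_range]; omega) hpos fun _ _ _ => Nat.zero_le _

lemma IsReduced.exists_perm_mult_ne_of_lt {c : List ℕ} {x y z : ℕ}
    (h : IsReduced (c ++ [x, y, z])) (hyz : y < z) :
    ∃ b x' y', (b ++ [x', y']).Perm (c ++ [x, y, z]) ∧
      mult (b ++ [x' + y']) 0 ≠ mult (b ++ [x' - 1, y' - 1]) 0 := by
  have hx : 0 < x := h.1.1 x (by simp)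
  have hy : 0 < y := h.1.1 y (by simp)
  have hperm : (c ++ [z] ++ [x, y]).Perm (c ++ [x, y, z]) := by
    rw [List.append_assoc]
    exact List.perm_append_comm.append_left c
  have hperm' : (c ++ [y] ++ [x, z]).Perm (c ++ [x, y, z]) := by
    rw [List.append_assoc]
    exact (List.Perm.swap x y [z]).append_left c
  by_contra! hcon
  have hmerge := mult_clebschGordan (c ++ [z]) hx hy
  have hmerge' := mult_clebschGordan (c ++ [y]) hx (hy.trans hyz)
  rw [← hcon _ _ _ hperm, mult_perm hperm, List.append_assoc, List.singleton_append] at hmerge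
  rw [← hcon _ _ _ hperm', mult_perm hperm', List.append_assoc, List.singleton_append] at hmerge'
  have := h.mult_merge_lt hyz
  omega

lemma exists_append_perm_of_not_const {a : List ℕ} (ha : 3 ≤ a.length)
    (hne : ¬ ∃ t, ∀ x ∈ a, x = t) : ∃ c x y z, y < z ∧ (c ++ [x, y, z]).Perm a := by
  obtain ⟨y, hy, z, hz, hyz⟩ : ∃ y ∈ a, ∃ z ∈ a, y < z := by
    push Not at hne
    obtain ⟨y, hy, -⟩ := hne 0
    obtain ⟨z, hz, hzy⟩ := hne y
    rcases hzy.lt_or_gt with hlt | hlt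
    · exact ⟨z, hz, y, hy, hlt⟩
    · exact ⟨y, hy, z, hz, hlt⟩
  have hsub : List.Subperm [y, z] a :=
    List.subperm_of_subset (by simpa using hyz.ne) (by simp [hy, hz])
  obtain ⟨x, l, hl, hla⟩ := hsub.exists_of_length_lt ha
  obtain ⟨c, hc⟩ := hla.exists_perm_append
  exact ⟨c, x, y, z, hyz, (List.perm_append_comm.trans (hl.symm.append_right c)).trans hc.symm⟩

lemma mult_replicate_one_ne {n : ℕ} (hn : 3 ≤ n) (heven : Even n) :
    mult (List.replicate n 1) 2 ≠ mult (List.replicate n 1) 0 := by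
  obtain ⟨n, rfl⟩ := Nat.exists_eq_add_of_le' (Nat.one_le_of_lt hn)
  obtain ⟨r, hr⟩ := heven
  have hpos : 0 < mult (List.replicate n 1) 3 :=
    mult_replicate_pos ⟨r + 1, by omega⟩ (by omega) (by omega)
  have htwo : mult (List.replicate (n + 1) 1) 2 =
      mult (List.replicate n 1) 3 + mult (List.replicate n 1) 1 := by
    simp [List.replicate_succ, mult, sum_range_succ]
  rw [htwo, List.replicate_succ, mult_zero_cons]
  omega

/-- Read off from the first-order differential equation satisfied by
`(z - z⁻¹) * (z⁻² + 1 + z²) ^ n`. -/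
lemma weylNumerator_replicate_two_recurrence (n : ℕ) (m : ℤ) :
    (2 * n + m + 4) * weylNumerator (List.replicate n 2) (m + 3) +
        (2 * n - m + 4) * weylNumerator (List.replicate n 2) (m - 3) =
      2 * (n - 1) * (weylNumerator (List.replicate n 2) (m - 1) +
        weylNumerator (List.replicate n 2) (m + 1)) := by
  induction n generalizing m with
  | zero =>
    simp only [List.replicate_zero, weylNumerator, List.foldr_nil, numer, Pi.sub_apply,
      Pi.single_apply]
    by_cases hm : m ∈ ({-4, -2, 2, 4} : Finset ℤ)
    · fin_cases hm <;> norm_num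
    · grind
  | succ n ih =>
    have h := ih m
    have hl := ih (m - 2)
    have hr := ih (m + 2)
    simp only [List.replicate_succ, weylNumerator_cons, charMul_two]
    push_cast at hl hr ⊢
    ring_nf at h hl hr ⊢
    linear_combination h + hl + hr

/-- The Riordan numbers, which count the invariants in the tensor powers of the adjoint
representation of `SL₂`. -/
def riordan : ℕ → ℕ
  | 0 => 1
  | 1 => 0
  | n + 2 => (n + 1) * (2 * riordan (n + 1) + 3 * riordan n) / (n + 3)

lemma mult_replicate_two_two (n : ℕ) :
    mult (List.replicate n 2) 2 = mult (List.replicate (n + 1) 2) 0 :=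
  (mult_zero_cons 2 _).symm

lemma mult_replicate_two_four_add (n : ℕ) :
    mult (List.replicate n 2) 4 + mult (List.replicate n 2) 2 + mult (List.replicate n 2) 0 =
      mult (List.replicate (n + 2) 2) 0 := by
  rw [← mult_replicate_two_two]
  simp [List.replicate_succ, mult, sum_range_succ]

lemma mult_replicate_two_zero_add_two (n : ℕ) :
    (n + 3) * mult (List.replicate (n + 2) 2) 0 = (n + 1) *
      (2 * mult (List.replicate (n + 1) 2) 0 + 3 * mult (List.replicate n 2) 0) := by
  have hrec := weylNumerator_replicate_two_recurrence n 2
  have hodd := odd_weylNumerator (List.replicate n 2) 1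
  have h₀ := mult_eq_weylNumerator (List.replicate n 2) 0
  have h₂ := mult_eq_weylNumerator (List.replicate n 2) 2
  have h₄ := mult_eq_weylNumerator (List.replicate n 2) 4
  norm_num at hrec hodd h₀ h₂ h₄
  rw [hodd, ← h₀, ← h₂, ← h₄] at hrec
  rw [← mult_replicate_two_four_add, ← mult_replicate_two_two]
  qify
  linear_combination hrec / 2

lemma mult_replicate_two_zero (n : ℕ) : mult (List.replicate n 2) 0 = riordan n := by
  induction n using Nat.twoStepInduction with
  | zero => rfl
  | one => rfl
  | more n ih ih' =>
    rw [riordan, ← ih, ← ih']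
    exact Nat.eq_div_of_mul_eq_right (by omega) (mult_replicate_two_zero_add_two n)

lemma mult_replicate_two_ne {n : ℕ} (hn : 2 ≤ n) :
    mult (List.replicate n 2) 4 ≠ mult (List.replicate n 2) 0 + mult (List.replicate n 2) 2 := by
  intro h
  have hpos : 0 < mult (List.replicate n 2) 0 :=
    mult_replicate_pos (by simp) (Nat.zero_le _) (by omega)
  have hradial : mult (List.replicate n 2) 2 ≤ 3 * mult (List.replicate n 2) 0 := by
    have := mem_radialCone.1 (weylNumerator_replicate_mem_radialCone 2 hn) 1
    qify
    rw [mult_eq_weylNumerator, mult_eq_weylNumerator]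
    norm_num at this ⊢
    exact this
  have hratio : 4 * mult (List.replicate n 2) 2 + 3 * mult (List.replicate n 2) 0 =
      n * mult (List.replicate n 2) 0 := by
    have hrec := mult_replicate_two_zero_add_two n
    rw [← mult_replicate_two_four_add, ← mult_replicate_two_two, h] at hrec
    zify at hrec ⊢
    linear_combination hrec
  have hlt : n < 16 := by nlinarith
  rw [mult_replicate_two_two, mult_replicate_two_zero, mult_replicate_two_zero] at hratio
  revert hratio
  exact (by decide : ∀ n < 16, 4 * riordan (n + 1) + 3 * riordan n ≠ n * riordan n) n hlt

lemma mult_replicate_lt {t n : ℕ} (ht : 3 ≤ t) (hn : 2 ≤ n) (heven : Even (n * t)) :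
    mult (List.replicate n t) (2 * t) < ∑ i ∈ range t, mult (List.replicate n t) (2 * i) := by
  have hpos : 0 < mult (List.replicate n t) (2 * t) :=
    mult_replicate_pos ((even_two_mul t).add heven) (Nat.mul_le_mul_right t hn)
      (Nat.le_add_right _ _)
  have hcone := weylNumerator_replicate_mem_radialCone t hn
  qify at hpos ⊢
  simp only [mult_eq_weylNumerator] at hpos ⊢
  push_cast at hpos ⊢
  exact lt_sum_of_mem_radialCone hcone ht hpos

lemma mult_replicate_append_ne {t n : ℕ} (ht : 0 < t) (hn : 2 ≤ n) (heven : Even (n * t))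
    (hone : ¬ (t = 1 ∧ n = 2)) :
    mult (List.replicate n t ++ [t + t]) 0 ≠ mult (List.replicate n t ++ [t - 1, t - 1]) 0 := by
  have hsum : mult (List.replicate n t ++ [t - 1, t - 1]) 0 =
      ∑ i ∈ range t, mult (List.replicate n t) (2 * i) := by
    rw [mult_append_pair, min_self, Nat.sub_add_cancel ht, ← sum_range_reflect]
    refine sum_congr rfl fun i hi => congrArg _ ?_
    have := mem_range.1 hi
    omega
  rw [mult_append_singleton, hsum, ← two_mul]
  rcases (by omega : t = 1 ∨ t = 2 ∨ 3 ≤ t) with rfl | rfl | ht₃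
  · simpa using mult_replicate_one_ne (by grind) (by simpa using heven)
  · simpa [sum_range_succ] using mult_replicate_two_ne hn
  · exact (mult_replicate_lt ht₃ hn heven).ne

lemma IsReduced.exists_perm_mult_ne {a : List ℕ} (ha : IsReduced a) (hlen : 4 ≤ a.length)
    (hne : a ≠ [1, 1, 1, 1]) :
    ∃ b x y, (b ++ [x, y]).Perm a ∧ mult (b ++ [x + y]) 0 ≠ mult (b ++ [x - 1, y - 1]) 0 := by
  by_cases hconst : ∃ t, ∀ x ∈ a, x = t
  · obtain ⟨t, ht⟩ := hconst
    obtain ⟨n, hn⟩ := Nat.exists_eq_add_of_le' hlen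
    obtain rfl : a = List.replicate (n + 2) t ++ [t, t] := by
      rw [List.eq_replicate_of_mem ht, hn]
      exact List.replicate_add (n + 2) 2 t
    refine ⟨_, t, t, .refl _, mult_replicate_append_ne (ha.1.1 t (by simp)) (by omega) ?_ ?_⟩
    · simpa [Nat.even_add] using ha.1.2
    · rintro ⟨rfl, hn'⟩
      exact hne (by rw [hn']; rfl)
  · obtain ⟨c, x, y, z, hyz, hperm⟩ := exists_append_perm_of_not_const (by omega) hconst
    obtain ⟨b, x', y', hperm', hmult⟩ := (ha.perm hperm.symm).exists_perm_mult_ne_of_lt hyz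
    exact ⟨b, x', y', hperm'.trans hperm, hmult⟩

end SchubertLines

theorem lemmaL :
    (∀ a : List ℕ, SchubertLines.IsReduced a → 4 ≤ a.length → a ≠ [1, 1, 1, 1] →
      ∃ (b : List ℕ) (x y : ℕ), (b ++ [x, y]).Perm a ∧
        SchubertLines.K (b ++ [x + y]) ≠ SchubertLines.K (b ++ [x - 1, y - 1]) ∧
        SchubertLines.K (b ++ [x + y]) ≠ 0 ∧
        SchubertLines.K (b ++ [x - 1, y - 1]) ≠ 0) ∧
    (SchubertLines.K [1, 1, 1 + 1] = 1 ∧ SchubertLines.K [1, 1, 1 - 1, 1 - 1] = 1) := by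
  refine ⟨fun a ha hlen hne => ?_, ?_, ?_⟩
  · obtain ⟨b, x, y, hperm, hmult⟩ := ha.exists_perm_mult_ne hlen hne
    have hred := ha.perm hperm.symm
    have hx : 0 < x := hred.1.1 x (by simp)
    have hy : 0 < y := hred.1.1 y (by simp)
    have heven := hred.1.2
    have hmerge : SchubertLines.K (b ++ [x + y]) = SchubertLines.mult (b ++ [x + y]) 0 :=
      SchubertLines.K_eq_mult (by simpa using heven)
    have hlower : SchubertLines.K (b ++ [x - 1, y - 1]) =
        SchubertLines.mult (b ++ [x - 1, y - 1]) 0 :=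
      SchubertLines.K_eq_mult <| by
        simp only [List.sum_append, List.sum_cons, List.sum_nil, Nat.even_iff] at heven ⊢
        omega
    rw [← hmerge, ← hlower] at hmult
    exact ⟨b, x, y, hperm, hmult, hmerge ▸ hred.mult_merge_pos.ne',
      hlower ▸ hred.mult_lower_pos.ne'⟩
  · rw [SchubertLines.K_eq_mult ⟨2, rfl⟩]
    rfl
  · rw [SchubertLines.K_eq_mult ⟨1, rfl⟩]
    rfl
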